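/- Let $(\mathcal M,d)$ be a complete NPC space, i.e. a complete metric space in which any two points are connected by a geodesic (a path $\gamma:[0,1]\to\mathcal M$ with $d(\gamma(s),\gamma(t))=(t-s)\,d(\gamma(0),\gamma(1))$ for $0\le s\le t\le 1$) and such that, for every $p\in\mathcal M$, every geodesic $\gamma$ and every $t\in[0,1]$, \[d^2(p,\gamma(t))\le(1-t)\,d^2(p,\gamma(0))+t\,d^2(p,\gamma(1))-t(1-t)\,d^2(\gamma(0),\gamma(1)).\] A function $f:\mathcal M\to\mathbb R$ is geodesically concave if $f\circ\gamma$ is concave on $[0,1]$ for every geodesic $\gamma$. A barycenter of a Borel probability measure $P$ on $\mathcal M$ with $\int d^2(x,y)\,\mathrm dP(y)<\infty$ for all $x$ is a minimizer of $x\mapsto\int d^2(x,y)\,\mathrm dP(y)$. Let $\mathcal Z$ be a measurable space and let $\ell:\mathcal M\times\mathcal Z\to\mathbb R$ be a measurable loss such that, for every $z\in\mathcal Z$, the function $\ell(\cdot,z)$ is lower semicontinuous. Suppose that there is $\beta>0$ such that, for every $z\in\mathcal Z$, the function $e^{-\beta\ell(\cdot,z)}$ is geodesically concave. Let $\Theta\subset\mathcal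 M$ be finite and non-empty, let $n\ge1$, and let $Z_1,\dots,Z_n,Z$ be independent and identically distributed $\mathcal Z$-valued random variables such that $\ell(\theta,Z)$ is integrable for every $\theta\in\Theta$. Let $m_1$ be the barycenter of the uniform measure on $\Theta$ and, for $2\le i\le n+1$, let $m_i=m_i(Z_1,\dots,Z_{i-1})$ be the barycenter of the (random) probability measure \[\sum_{\theta\in\Theta}\pi_{\theta,i}\,\delta_\theta,\qquad \pi_{\theta,i}=\frac{e^{-\beta\sum_{j=1}^{i-1}\ell(\theta,Z_j)}}{\sum_{\vartheta\in\Theta}e^{-\beta\sum_{j=1}^{i-1}\ell(\vartheta,Z_j)}}.\] Let $\theta_n$ be the barycenter of $\frac1{n+1}\sum_{i=1}^{n+1}\delta_{m_i}$, i.e. the minimizer of $m\mapsto\sum_{i=1}^{n+1}d^2(m,m_i)$. Then all these barycenters exist and are unique, $\ell(\theta_n,Z)$ is a random variable whose positive part is integrable (so that $\mathbb E[\ell(\theta_n,Z)]\in[-\infty,\infty)$ is well defined), and \[\mathbb E[\ell(\theta_n,Z)]-\inf_{\theta\in\Theta}\mathbb E[\ell(\theta,Z)]\le\frac{\ln|\Theta|}{\beta(n+1)}.\]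 -/

import Mathlib

open Set MeasureTheory ProbabilityTheory
open scoped ENNReal

/-- `γ`, restricted to `[0,1]`, is a (constant speed, minimizing) geodesic. Only the values of `γ`
on `[0,1]` matter; continuity on `[0,1]` is automatic. -/
def IsGeodesicPath {M : Type*} [MetricSpace M] (γ : ℝ → M) : Prop :=
  ∀ s t : ℝ, 0 ≤ s → s ≤ t → t ≤ 1 → dist (γ s) (γ t) = (t - s) * dist (γ 0) (γ 1)

/-- Every two points are connected by a geodesic. -/
def IsGeodesicSpace (M : Type*) [MetricSpace M] : Prop :=
  ∀ x y : M, ∃ γ : ℝ → M, IsGeodesicPath γ ∧ γ 0 = x ∧ γ 1 = y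

/-- Geodesic spaces of (global) non-positive curvature. Completeness is a separate assumption. -/
def IsNPCSpace (M : Type*) [MetricSpace M] : Prop :=
  IsGeodesicSpace M ∧
    ∀ (p : M) (γ : ℝ → M), IsGeodesicPath γ → ∀ t ∈ Icc (0 : ℝ) 1,
      dist p (γ t) ^ 2 ≤ (1 - t) * dist p (γ 0) ^ 2 + t * dist p (γ 1) ^ 2
        - t * (1 - t) * dist (γ 0) (γ 1) ^ 2

/-- Geodesic convexity of a real-valued function. -/
def GeodesicallyConvex {M : Type*} [MetricSpace M] (f : M → ℝ) : Prop :=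
  ∀ γ : ℝ → M, IsGeodesicPath γ → ConvexOn ℝ (Icc (0 : ℝ) 1) (fun t => f (γ t))

/-- `f` is geodesically concave if `-f` is geodesically convex. -/
def GeodesicallyConcave {M : Type*} [MetricSpace M] (f : M → ℝ) : Prop :=
  GeodesicallyConvex (fun x => -f x)

/-- Borel probability measures with finite second moment around every point. -/
def MemP2 {M : Type*} [MetricSpace M] [MeasurableSpace M] (P : Measure M) : Prop :=
  IsProbabilityMeasure P ∧ ∀ x : M, ∫⁻ y, edist x y ^ 2 ∂P < ⊤

/-- `x` is a barycenter of `P ∈ 𝒫₂(M)`: it minimizes `x ↦ ∫ d²(x,y) dP(y)`. -/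
def IsBarycenter {M : Type*} [MetricSpace M] [MeasurableSpace M] (P : Measure M) (x : M) : Prop :=
  MemP2 P ∧ ∀ x' : M, ∫⁻ y, edist x y ^ 2 ∂P ≤ ∫⁻ y, edist x' y ^ 2 ∂P

/-- A barycenter of `P` (an unspecified point of `M` if there is none). -/
noncomputable def barycenter {M : Type*} [MetricSpace M] [MeasurableSpace M] [Nonempty M]
    (P : Measure M) : M :=
  Classical.epsilon (IsBarycenter P)

/-- The cumulative loss `∑_{j ≤ t} ℓ(θ, z_j)` of the constant expert `θ` over the first `t` of the
outcomes `z_1, …, z_n` (the outcome `z_j` is `z (j - 1)` in Lean). -/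
noncomputable def cumLoss {M 𝒵 : Type*} (ℓ : M → 𝒵 → ℝ) {n : ℕ} (z : Fin n → 𝒵)
    (t : Fin (n + 1)) (θ : M) : ℝ :=
  ∑ j ∈ Finset.univ.filter (fun j : Fin n => j.val < t.val), ℓ θ (z j)

/-- The exponential weight `π_{θ, t+1}`, computed from the first `t` outcomes. -/
noncomputable def ewaWeight {M 𝒵 : Type*} (β : ℝ) (ℓ : M → 𝒵 → ℝ) (Θ : Finset M) {n : ℕ}
    (z : Fin n → 𝒵) (t : Fin (n + 1)) (θ : M) : ℝ :=
  Real.exp (-β * cumLoss ℓ z t θ) / ∑ ϑ ∈ Θ, Real.exp (-β * cumLoss ℓ z t ϑ)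

/-- Before any outcome is seen, the weights are uniform. -/
theorem ewaWeight_zero {M 𝒵 : Type*} (β : ℝ) (ℓ : M → 𝒵 → ℝ) (Θ : Finset M) {n : ℕ}
    (z : Fin n → 𝒵) (θ : M) : ewaWeight β ℓ Θ z 0 θ = 1 / (Θ.card : ℝ) := by
  simp [ewaWeight, cumLoss]

/-- The measure `∑_{θ ∈ Θ} π_{θ, t+1} δ_θ`. For `t = 0` it is the uniform measure on `Θ`. -/
noncomputable def ewaMeasure {M 𝒵 : Type*} [MeasurableSpace M] (β : ℝ) (ℓ : M → 𝒵 → ℝ)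
    (Θ : Finset M) {n : ℕ} (z : Fin n → 𝒵) (t : Fin (n + 1)) : Measure M :=
  ∑ θ ∈ Θ, ENNReal.ofReal (ewaWeight β ℓ Θ z t θ) • Measure.dirac θ

/-- The prediction `m_{t+1}(z_1, …, z_t)` of the EWA forecaster, for `t = 0, …, n`. -/
noncomputable def ewaPrediction {M 𝒵 : Type*} [MetricSpace M] [MeasurableSpace M] [Nonempty M]
    (β : ℝ) (ℓ : M → 𝒵 → ℝ) (Θ : Finset M) {n : ℕ} (z : Fin n → 𝒵) (t : Fin (n + 1)) : M :=
  barycenter (ewaMeasure β ℓ Θ z t)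

/-- The measure `(1/(n+1)) ∑_{i=1}^{n+1} δ_{m_i(z_1, …, z_{i-1})}`. -/
noncomputable def otbMeasure {M 𝒵 : Type*} [MetricSpace M] [MeasurableSpace M] [Nonempty M]
    (β : ℝ) (ℓ : M → 𝒵 → ℝ) (Θ : Finset M) {n : ℕ} (z : Fin n → 𝒵) : Measure M :=
  ∑ t : Fin (n + 1), ((n : ℝ≥0∞) + 1)⁻¹ • Measure.dirac (ewaPrediction β ℓ Θ z t)

/-- The online-to-batch estimator `θ_n` computed from the sample `z_1, …, z_n`. -/
noncomputable def otbEstimator {M 𝒵 : Type*} [MetricSpace M] [MeasurableSpace M] [Nonempty M]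
    (β : ℝ) (ℓ : M → 𝒵 → ℝ) (Θ : Finset M) {n : ℕ} (z : Fin n → 𝒵) : M :=
  barycenter (otbMeasure β ℓ Θ z)

/-- Extended-real-valued expectation `𝔼[X⁺] - 𝔼[X⁻]` of a real random variable. It is meaningful
as soon as one of the two terms is finite, and is the usual expectation if `X` is integrable. -/
noncomputable def extExpectation {Ω : Type*} [MeasurableSpace Ω] (μ : Measure Ω) (X : Ω → ℝ) :
    EReal :=
  ((∫⁻ ω, ENNReal.ofReal (X ω) ∂μ : ℝ≥0∞) : EReal)
    - ((∫⁻ ω, ENNReal.ofReal (-X ω) ∂μ : ℝ≥0∞) : EReal)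

/-! The soft minimum `softMin` is a potential for the exponential weights. If `u` lists the
cumulative losses and `v` the losses of the experts at a new outcome, the weighted mean of `exp (-β
v)` is `exp (-β (softMin (u + v) - softMin u))`. Concavity of `exp (-β ℓ)` and Jensen's inequality
at the barycenter then bound the loss of each prediction by this increment. A second use of Jensen,
at the barycenter of the predictions, bounds the loss of the estimator by the average increment
(`loss_otbEstimator_le`).

In expectation the fresh outcome can be exchanged with the next observation
(`identDistrib_lossVec_succ`), so the increments telescope. What remains is the soft minimum of `n +
1` losses, at most the sum for any fixed expert, minus the soft minimum of zero, which is `-log |Θ|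
/ β`.

The geometric input is existence, uniqueness, Jensen and continuity for finitely supported
barycenters; all rest on the uniform convexity of squared distances. Continuity is what makes the
estimator measurable. -/

open Filter Topology in
/-- A lower semicontinuous function that is bounded below and uniformly convex at midpoints attains
its minimum on a complete space. -/
theorem exists_minimizer_of_midpoint {M : Type*} [MetricSpace M] [CompleteSpace M] [Nonempty M]
    (F : M → ℝ) (hF : LowerSemicontinuous F) (h0 : ∀ x, 0 ≤ F x)
    (hmid : ∀ x y, ∃ m, F m ≤ (F x + F y) / 2 - dist x y ^ 2 / 4) :
    ∃ b, ∀ m, F b ≤ F m := by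
  have hbdd : BddBelow (range F) := ⟨0, by rintro _ ⟨x, rfl⟩; exact h0 x⟩
  set I := ⨅ x, F x with hI
  have hseq : ∀ k : ℕ, ∃ x, F x < I + 1 / ((k : ℝ) + 1) := fun k =>
    exists_lt_of_ciInf_lt (by rw [← hI]; linarith [Nat.one_div_pos_of_nat (α := ℝ) (n := k)])
  choose x hx using hseq
  have hlim : Tendsto (fun N : ℕ => I + 1 / ((N : ℝ) + 1)) atTop (𝓝 I) := by
    simpa using tendsto_const_nhds.add (tendsto_one_div_add_atTop_nhds_zero_nat (𝕜 := ℝ))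
  have hcauchy : CauchySeq x := by
    -- The value at the point supplied by `hmid` is at least the infimum, so two
    -- `1/(N+1)`-minimizers satisfy `d² / 4 ≤ 1/(N+1)`.
    refine cauchySeq_of_le_tendsto_0 (fun N : ℕ => Real.sqrt (4 * (1 / ((N : ℝ) + 1)))) ?_ ?_
    · intro i j N hi hj
      refine Real.le_sqrt_of_sq_le ?_
      obtain ⟨m, hm⟩ := hmid (x i) (x j)
      have h1 : I ≤ F m := ciInf_le hbdd m
      have h2 : 1 / ((i : ℝ) + 1) ≤ 1 / ((N : ℝ) + 1) := Nat.one_div_le_one_div hi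
      have h3 : 1 / ((j : ℝ) + 1) ≤ 1 / ((N : ℝ) + 1) := Nat.one_div_le_one_div hj
      linarith [hx i, hx j]
    · have := (tendsto_one_div_add_atTop_nhds_zero_nat (𝕜 := ℝ)).const_mul 4
      rw [mul_zero] at this
      simpa only [Real.sqrt_zero, Function.comp_def] using
        (Real.continuous_sqrt.tendsto 0).comp this
  obtain ⟨b, hb⟩ := cauchySeq_tendsto_of_complete hcauchy
  refine ⟨b, fun m => le_trans ?_ (ciInf_le hbdd m)⟩
  by_contra! hlt
  obtain ⟨c, hc1, hc2⟩ := exists_between hlt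
  have e1 := hb.eventually (hF b c hc2)
  have e2 := hlim.eventually (gt_mem_nhds hc1)
  obtain ⟨k, hk1, hk2⟩ := (e1.and e2).exists
  linarith [hx k]

/-- If `A ≤ t B` for all small positive `t`, then `A ≤ 0`. -/
theorem nonpos_of_forall_le_mul {A B : ℝ} (h : ∀ t : ℝ, 0 < t → t ≤ 1 → A ≤ t * B) : A ≤ 0 := by
  by_contra! hA
  have hB : 0 < B := by have := h 1 one_pos le_rfl; linarith
  have h1 := h (min 1 (A / (2 * B))) (by positivity) (min_le_left _ _)
  have h2 : min 1 (A / (2 * B)) * B ≤ A / (2 * B) * B :=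
    mul_le_mul_of_nonneg_right (min_le_right _ _) hB.le
  have h3 : A / (2 * B) * B = A / 2 := by field_simp
  linarith

/-! ### Finite weighted barycenters in NPC spaces -/

/-- The weighted sum of squared distances from `m` to the points `x i`. -/
noncomputable def weightedVar {M ι : Type*} [MetricSpace M] [Fintype ι] (w : ι → ℝ) (x : ι → M)
    (m : M) : ℝ := ∑ i, w i * dist m (x i) ^ 2

/-- `b` minimizes the weighted sum of squared distances to the points `x i`. -/
def IsWeightedBary {M ι : Type*} [MetricSpace M] [Fintype ι] (w : ι → ℝ) (x : ι → M)
    (b : M) : Prop := ∀ m, weightedVar w x b ≤ weightedVar w x m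

section WeightedBary

variable {M ι : Type*} [MetricSpace M] [Fintype ι] {w : ι → ℝ} {x : ι → M} {b : M}

theorem weightedVar_nonneg (hw : ∀ i, 0 ≤ w i) (m : M) : 0 ≤ weightedVar w x m :=
  Finset.sum_nonneg fun i _ => mul_nonneg (hw i) (sq_nonneg _)

theorem weightedVar_geodesic (hM : IsNPCSpace M) (hw : ∀ i, 0 ≤ w i) (hw1 : ∑ i, w i = 1)
    {γ : ℝ → M} (hγ : IsGeodesicPath γ) {t : ℝ} (ht : t ∈ Icc (0 : ℝ) 1) :
    weightedVar w x (γ t) ≤ (1 - t) * weightedVar w x (γ 0) + t * weightedVar w x (γ 1)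
      - t * (1 - t) * dist (γ 0) (γ 1) ^ 2 := by
  have h : weightedVar w x (γ t) ≤ ∑ i, w i * ((1 - t) * dist (γ 0) (x i) ^ 2
      + t * dist (γ 1) (x i) ^ 2 - t * (1 - t) * dist (γ 0) (γ 1) ^ 2) := by
    refine Finset.sum_le_sum fun i _ => mul_le_mul_of_nonneg_left ?_ (hw i)
    simpa only [dist_comm (x i)] using hM.2 (x i) γ hγ t ht
  refine h.trans_eq ?_
  calc _ = (1 - t) * weightedVar w x (γ 0) + t * weightedVar w x (γ 1)
      - (∑ i, w i) * (t * (1 - t) * dist (γ 0) (γ 1) ^ 2) := by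
        simp only [weightedVar, Finset.mul_sum, Finset.sum_mul]
        rw [← Finset.sum_add_distrib, ← Finset.sum_sub_distrib]
        exact Finset.sum_congr rfl fun i _ => by ring
    _ = _ := by rw [hw1, one_mul]

theorem exists_isWeightedBary [CompleteSpace M] [Nonempty M] (hM : IsNPCSpace M)
    (hw : ∀ i, 0 ≤ w i) (hw1 : ∑ i, w i = 1) : ∃ b, IsWeightedBary w x b := by
  refine exists_minimizer_of_midpoint (weightedVar w x) ?_ (weightedVar_nonneg hw) ?_
  · refine Continuous.lowerSemicontinuous ?_
    unfold weightedVar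
    fun_prop
  · intro y z
    obtain ⟨γ, hγ, h0, h1⟩ := hM.1 y z
    refine ⟨γ (1 / 2), (weightedVar_geodesic hM hw hw1 hγ ⟨by norm_num, by norm_num⟩).trans ?_⟩
    rw [h0, h1]
    linarith

/-- The variance inequality. -/
theorem IsWeightedBary.variance_le (hM : IsNPCSpace M) (hb : IsWeightedBary w x b)
    (hw : ∀ i, 0 ≤ w i) (hw1 : ∑ i, w i = 1) (m : M) :
    weightedVar w x b + dist b m ^ 2 ≤ weightedVar w x m := by
  obtain ⟨γ, hγ, h0, h1⟩ := hM.1 b m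
  -- First variation at the minimizer: compare `b` with `γ t`, divide by `t` and let `t` tend to
  -- `0`.
  have key : weightedVar w x b + dist b m ^ 2 - weightedVar w x m ≤ 0 := by
    refine nonpos_of_forall_le_mul (B := dist b m ^ 2) fun t ht ht1 => ?_
    have h := weightedVar_geodesic (x := x) hM hw hw1 hγ ⟨ht.le, ht1⟩
    rw [h0, h1] at h
    have h2 := hb (γ t)
    refine le_of_mul_le_mul_left ?_ ht
    linarith
  linarith

theorem IsWeightedBary.unique (hM : IsNPCSpace M) (hw : ∀ i, 0 ≤ w i) (hw1 : ∑ i, w i = 1)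
    {b' : M} (hb : IsWeightedBary w x b) (hb' : IsWeightedBary w x b') : b = b' := by
  have h := hb.variance_le hM hw hw1 b'
  have h' := hb' b
  have : dist b b' ^ 2 ≤ 0 := by linarith
  exact dist_eq_zero.1 (pow_eq_zero_iff two_ne_zero |>.1 (le_antisymm this (sq_nonneg _)))

/-- Jensen's inequality for barycenters in NPC spaces. -/
theorem IsWeightedBary.jensen [CompleteSpace M] (hM : IsNPCSpace M)
    (hb : IsWeightedBary w x b) (hw : ∀ i, 0 ≤ w i) (hw1 : ∑ i, w i = 1)
    {f : M → ℝ} (hf : LowerSemicontinuous f) (hconv : GeodesicallyConvex f) :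
    f b ≤ ∑ i, w i * f (x i) := by
  have : Nonempty M := ⟨b⟩
  set c := ∑ i, w i * f (x i) with hc
  have hgeo : ∀ {γ : ℝ → M}, IsGeodesicPath γ → ∀ {t : ℝ}, 0 ≤ t → t ≤ 1 →
      f (γ t) ≤ (1 - t) * f (γ 0) + t * f (γ 1) := by
    intro γ hγ t ht ht1
    have := (hconv γ hγ).2 (left_mem_Icc.2 zero_le_one) (right_mem_Icc.2 zero_le_one)
      (sub_nonneg.2 ht1) ht (by ring)
    simpa using this
  have hmono : Monotone fun s : ℝ => max (s - c) 0 ^ 2 := fun s s' h =>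
    pow_le_pow_left₀ (le_max_right _ _) (max_le_max (by linarith) le_rfl) 2
  -- In effect, `(b, c)` is projected onto the epigraph of `f` in `M × ℝ`: the best height above `m`
  -- is `max (f m) c`, which leaves the penalty `max (f m - c) 0 ^ 2`. The positive part also makes
  -- the functional bounded below although `f` need not be.
  obtain ⟨p, hp⟩ : ∃ p, ∀ m, dist b p ^ 2 + max (f p - c) 0 ^ 2
      ≤ dist b m ^ 2 + max (f m - c) 0 ^ 2 := by
    refine exists_minimizer_of_midpoint (fun m => dist b m ^ 2 + max (f m - c) 0 ^ 2) ?_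
      (fun m => by positivity) ?_
    · refine LowerSemicontinuous.add (Continuous.lowerSemicontinuous (by fun_prop)) ?_
      exact Continuous.comp_lowerSemicontinuous (g := fun s : ℝ => max (s - c) 0 ^ 2)
        (by fun_prop) hf hmono
    · intro y z
      obtain ⟨γ, hγ, h0, h1⟩ := hM.1 y z
      refine ⟨γ (1 / 2), ?_⟩
      have hd := hM.2 b γ hγ (1 / 2) ⟨by norm_num, by norm_num⟩
      have hm := hmono (hgeo hγ (t := 1 / 2) (by norm_num) (by norm_num))
      rw [h0, h1] at hd hm
      have h2 : max ((1 - 1 / 2) * f y + 1 / 2 * f z - c) 0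
          ≤ (max (f y - c) 0 + max (f z - c) 0) / 2 := by
        refine max_le ?_ (by positivity)
        linarith [le_max_left (f y - c) 0, le_max_left (f z - c) 0]
      have h3 := pow_le_pow_left₀ (le_max_right _ _) h2 2
      dsimp only at hm
      nlinarith [sq_nonneg (max (f y - c) 0 - max (f z - c) 0)]
  set s := max (f p - c) 0 with hs
  have hs0 : 0 ≤ s := le_max_right _ _
  -- Obtuse-angle inequality for that projection, tested against the epigraph point `(y, f y)`; it
  -- is the first variation along the geodesic from `p` to `y`.
  have hvar : ∀ y, dist b p ^ 2 + dist p y ^ 2 + 2 * s * (s - (f y - c)) ≤ dist b y ^ 2 := by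
    intro y
    obtain ⟨γ, hγ, h0, h1⟩ := hM.1 p y
    suffices h : dist b p ^ 2 + dist p y ^ 2 + 2 * s * (s - (f y - c)) - dist b y ^ 2 ≤ 0 by
      linarith
    refine nonpos_of_forall_le_mul (B := dist p y ^ 2 + (s - (f y - c)) ^ 2) fun t ht ht1 => ?_
    have hd := hM.2 b γ hγ t ⟨ht.le, ht1⟩
    have hm := hmono (hgeo hγ ht.le ht1)
    rw [h0, h1] at hd hm
    dsimp only at hm
    have hle : max ((1 - t) * f p + t * f y - c) 0 ≤ |(1 - t) * s + t * (f y - c)| := by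
      refine max_le (le_trans ?_ (le_abs_self _)) (abs_nonneg _)
      nlinarith [mul_le_mul_of_nonneg_left (le_max_left (f p - c) 0) (sub_nonneg.2 ht1)]
    have h3 := pow_le_pow_left₀ (le_max_right _ _) hle 2
    rw [sq_abs] at h3
    have h4 := hp (γ t)
    refine le_of_mul_le_mul_left ?_ ht
    nlinarith
  have hsum : ∑ i, w i * (dist b p ^ 2 + dist p (x i) ^ 2 + 2 * s * (s - (f (x i) - c)))
      ≤ weightedVar w x b :=
    Finset.sum_le_sum fun i _ => mul_le_mul_of_nonneg_left (hvar (x i)) (hw i)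
  -- Averaging cancels the terms in `f (x i) - c`, since `c` is their mean. Minimality of `b` then
  -- forces both `dist b p` and `s` to vanish.
  have hexp : ∑ i, w i * (dist b p ^ 2 + dist p (x i) ^ 2 + 2 * s * (s - (f (x i) - c)))
      = weightedVar w x p + (dist b p ^ 2 + 2 * s * s) := by
    have : ∀ i, w i * (dist b p ^ 2 + dist p (x i) ^ 2 + 2 * s * (s - (f (x i) - c)))
        = w i * dist p (x i) ^ 2 + w i * (dist b p ^ 2 + 2 * s * (s + c))
          - 2 * s * (w i * f (x i)) := fun i => by ring
    simp only [this]
    rw [Finset.sum_sub_distrib, Finset.sum_add_distrib, ← Finset.sum_mul, ← Finset.mul_sum, ← hc,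
      hw1, weightedVar]
    ring
  have hbp := hb p
  have hzero : dist b p ^ 2 + 2 * s * s ≤ 0 := by linarith
  have hss : 0 ≤ s * s := mul_self_nonneg s
  have hd0 : dist b p ^ 2 = 0 := le_antisymm (by linarith) (sq_nonneg _)
  have hs1 : s * s = 0 := le_antisymm (by nlinarith [sq_nonneg (dist b p)]) hss
  have hbp' : b = p := dist_eq_zero.1 (pow_eq_zero_iff two_ne_zero |>.1 hd0)
  have hs2 : s = 0 := mul_self_eq_zero.1 hs1
  have := le_max_left (f p - c) 0
  rw [← hs, hs2] at this
  rw [hbp']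
  linarith

open Filter Topology in
/-- Barycenters depend continuously on the weights and on the points. -/
theorem tendsto_of_isWeightedBary (hM : IsNPCSpace M) {α : Type*} {l : Filter α}
    {w' : α → ι → ℝ} {x' : α → ι → M} {b' : α → M}
    (hw0 : ∀ i, 0 ≤ w i) (hw' : ∀ a i, 0 ≤ w' a i) (hw1' : ∀ a, ∑ i, w' a i = 1)
    (hb' : ∀ a, IsWeightedBary (w' a) (x' a) (b' a)) (hb : IsWeightedBary w x b)
    (hw : ∀ i, Tendsto (fun a => w' a i) l (𝓝 (w i)))
    (hx : ∀ i, Tendsto (fun a => x' a i) l (𝓝 (x i))) : Tendsto b' l (𝓝 b) := by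
  have hV : Tendsto (fun a => weightedVar (w' a) (x' a) b) l (𝓝 (weightedVar w x b)) :=
    tendsto_finsetSum _ fun i _ => (hw i).mul ((tendsto_const_nhds.dist (hx i)).pow 2)
  have hvar : ∀ a, weightedVar (w' a) (x' a) (b' a) + dist (b' a) b ^ 2
      ≤ weightedVar (w' a) (x' a) b := fun a => (hb' a).variance_le hM (hw' a) (hw1' a) b
  have hV0 : 0 ≤ weightedVar w x b := weightedVar_nonneg hw0 b
  set R := weightedVar w x b + 2 with hRdef
  have hR : ∀ᶠ a in l, dist (b' a) b ≤ R := by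
    filter_upwards [hV.eventually (gt_mem_nhds (lt_add_one (weightedVar w x b)))] with a ha
    have h1 := hvar a
    have h2 := weightedVar_nonneg (x := x' a) (hw' a) (b' a)
    nlinarith [sq_nonneg (dist (b' a) b - 1), dist_nonneg (x := b' a) (y := b)]
  -- `E` dominates the change of the functional at `b' a` when weights and points are perturbed,
  -- uniformly on the ball of radius `R` around `b`. This transfers the minimality of `b` to the
  -- perturbed problem.
  set E : α → ℝ := fun a => ∑ i, (|w i - w' a i| * (R + dist b (x' a i)) ^ 2
    + w i * (dist (x i) (x' a i) * (2 * R + dist b (x i) + dist b (x' a i)))) with hE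
  have hE0 : Tendsto E l (𝓝 0) := by
    have : Tendsto E l (𝓝 (∑ i, (|w i - w i| * (R + dist b (x i)) ^ 2
        + w i * (dist (x i) (x i) * (2 * R + dist b (x i) + dist b (x i)))))) := by
      refine tendsto_finsetSum _ fun i _ => ?_
      have hd : Tendsto (fun a => dist b (x' a i)) l (𝓝 (dist b (x i))) :=
        tendsto_const_nhds.dist (hx i)
      refine Tendsto.add (Tendsto.mul (tendsto_const_nhds.sub (hw i)).abs
        ((tendsto_const_nhds.add hd).pow 2)) (tendsto_const_nhds.mul (Tendsto.mul
          (tendsto_const_nhds.dist (hx i)) (tendsto_const_nhds.add hd)))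
    simpa using this
  have hbound : ∀ᶠ a in l, dist (b' a) b ^ 2
      ≤ weightedVar (w' a) (x' a) b - weightedVar w x b + E a := by
    filter_upwards [hR] with a ha
    have h1 := hvar a
    have h2 := hb (b' a)
    have h3 : weightedVar w x (b' a) - weightedVar (w' a) (x' a) (b' a) ≤ E a := by
      rw [weightedVar, weightedVar, ← Finset.sum_sub_distrib]
      refine Finset.sum_le_sum fun i _ => ?_
      have t1 : dist (b' a) (x i) ≤ R + dist b (x i) :=
        (dist_triangle _ b _).trans (by linarith)
      have t2 : dist (b' a) (x' a i) ≤ R + dist b (x' a i) :=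
        (dist_triangle _ b _).trans (by linarith)
      have t3 : dist (b' a) (x i) - dist (b' a) (x' a i) ≤ dist (x i) (x' a i) := by
        have := dist_triangle (b' a) (x' a i) (x i)
        rw [dist_comm (x' a i)] at this
        linarith
      have p1 : (w i - w' a i) * dist (b' a) (x' a i) ^ 2
          ≤ |w i - w' a i| * (R + dist b (x' a i)) ^ 2 :=
        mul_le_mul (le_abs_self _) (pow_le_pow_left₀ dist_nonneg t2 2) (sq_nonneg _)
          (abs_nonneg _)
      have p2 : (dist (b' a) (x i) - dist (b' a) (x' a i))
            * (dist (b' a) (x i) + dist (b' a) (x' a i))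
          ≤ dist (x i) (x' a i) * (2 * R + dist b (x i) + dist b (x' a i)) :=
        mul_le_mul t3 (by linarith) (by positivity) dist_nonneg
      have p3 := mul_le_mul_of_nonneg_left p2 (hw0 i)
      linarith
    linarith
  have hlim : Tendsto (fun a => weightedVar (w' a) (x' a) b - weightedVar w x b + E a) l
      (𝓝 0) := by
    simpa using (hV.sub_const (weightedVar w x b)).add hE0
  have hsq : Tendsto (fun a => dist (b' a) b ^ 2) l (𝓝 0) :=
    tendsto_of_tendsto_of_tendsto_of_le_of_le' tendsto_const_nhds hlim
      (Eventually.of_forall fun a => sq_nonneg _) hbound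
  rw [tendsto_iff_dist_tendsto_zero]
  simpa [Function.comp_def, Real.sqrt_sq dist_nonneg] using
    (Real.continuous_sqrt.tendsto 0).comp hsq

end WeightedBary

/-! ### Barycenters of finitely supported measures -/

section DiscreteMeasure

variable {M ι : Type*} [MetricSpace M] [MeasurableSpace M] [BorelSpace M] [Fintype ι]
  {w : ι → ℝ} {x : ι → M}

theorem lintegral_edist_sq_sum_dirac (hw : ∀ i, 0 ≤ w i) (m : M) :
    ∫⁻ y, edist m y ^ 2 ∂(∑ i, ENNReal.ofReal (w i) • Measure.dirac (x i))
      = ENNReal.ofReal (weightedVar w x m) := by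
  rw [lintegral_finsetSum_measure, weightedVar,
    ENNReal.ofReal_sum_of_nonneg fun i _ => mul_nonneg (hw i) (sq_nonneg _)]
  refine Finset.sum_congr rfl fun i _ => ?_
  rw [lintegral_smul_measure, lintegral_dirac, smul_eq_mul, ENNReal.ofReal_mul (hw i),
    ENNReal.ofReal_pow dist_nonneg, edist_dist]

theorem isBarycenter_sum_dirac_iff (hw : ∀ i, 0 ≤ w i) (hw1 : ∑ i, w i = 1) (b : M) :
    IsBarycenter (∑ i, ENNReal.ofReal (w i) • Measure.dirac (x i)) b ↔ IsWeightedBary w x b := by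
  have hP : MemP2 (∑ i, ENNReal.ofReal (w i) • Measure.dirac (x i)) := by
    refine ⟨⟨?_⟩, fun m => ?_⟩
    · simp only [Measure.coe_finsetSum, Finset.sum_apply, Measure.smul_apply, measure_univ,
        smul_eq_mul, mul_one]
      rw [← ENNReal.ofReal_sum_of_nonneg fun i _ => hw i, hw1, ENNReal.ofReal_one]
    · rw [lintegral_edist_sq_sum_dirac hw]
      exact ENNReal.ofReal_lt_top
  simp only [IsBarycenter, hP, true_and, lintegral_edist_sq_sum_dirac hw, IsWeightedBary,
    ENNReal.ofReal_le_ofReal_iff (weightedVar_nonneg hw _)]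

variable [CompleteSpace M] [Nonempty M]

theorem existsUnique_isBarycenter_sum_dirac (hM : IsNPCSpace M) (hw : ∀ i, 0 ≤ w i)
    (hw1 : ∑ i, w i = 1) :
    ∃! b : M, IsBarycenter (∑ i, ENNReal.ofReal (w i) • Measure.dirac (x i)) b := by
  simp only [isBarycenter_sum_dirac_iff hw hw1]
  obtain ⟨b, hb⟩ := exists_isWeightedBary (x := x) hM hw hw1
  exact ⟨b, hb, fun b' hb' => hb'.unique hM hw hw1 hb⟩

theorem isWeightedBary_barycenter (hM : IsNPCSpace M) (hw : ∀ i, 0 ≤ w i)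
    (hw1 : ∑ i, w i = 1) :
    IsWeightedBary w x (barycenter (∑ i, ENNReal.ofReal (w i) • Measure.dirac (x i))) :=
  (isBarycenter_sum_dirac_iff hw hw1 _).1
    (Classical.epsilon_spec (existsUnique_isBarycenter_sum_dirac hM hw hw1).exists)

/-- Used to get Borel measurability of the estimator without separability of `M`. -/
theorem continuous_barycenter_sum_dirac (hM : IsNPCSpace M) {X : Type*} [TopologicalSpace X]
    {w : X → ι → ℝ} {x : X → ι → M} (hw : ∀ u i, 0 ≤ w u i) (hw1 : ∀ u, ∑ i, w u i = 1)
    (hwc : ∀ i, Continuous fun u => w u i) (hxc : ∀ i, Continuous fun u => x u i) :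
    Continuous fun u => barycenter (∑ i, ENNReal.ofReal (w u i) • Measure.dirac (x u i)) :=
  continuous_iff_continuousAt.2 fun u =>
    tendsto_of_isWeightedBary hM (hw u) hw hw1
      (fun v => isWeightedBary_barycenter hM (hw v) (hw1 v))
      (isWeightedBary_barycenter hM (hw u) (hw1 u))
      (fun i => (hwc i).continuousAt) (fun i => (hxc i).continuousAt)

end DiscreteMeasure

/-! ### Exponential weights and the soft minimum -/

section ExponentialWeights

variable {I : Type*} [Fintype I]

/-- The normalized exponential weights associated with the cumulative losses `u`. -/
noncomputable def expWeight (β : ℝ) (u : I → ℝ) (θ : I) : ℝ :=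
  Real.exp (-β * u θ) / ∑ ϑ, Real.exp (-β * u ϑ)

/-- The soft minimum `-(1/β) log ∑ exp(-β u)`. -/
noncomputable def softMin (β : ℝ) (u : I → ℝ) : ℝ :=
  -(Real.log (∑ θ, Real.exp (-β * u θ)) / β)

variable {β : ℝ}

theorem expWeight_nonneg (u : I → ℝ) (θ : I) : 0 ≤ expWeight β u θ :=
  div_nonneg (Real.exp_pos _).le (Finset.sum_nonneg fun _ _ => (Real.exp_pos _).le)

theorem softMin_zero : softMin β (0 : I → ℝ) = -(Real.log (Fintype.card I) / β) := by
  simp [softMin]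

theorem measurable_softMin : Measurable (softMin β : (I → ℝ) → ℝ) := by
  unfold softMin
  fun_prop

theorem softMin_le (hβ : 0 < β) (u : I → ℝ) (θ : I) : softMin β u ≤ u θ := by
  have h : Real.exp (-β * u θ) ≤ ∑ ϑ, Real.exp (-β * u ϑ) :=
    Finset.single_le_sum (f := fun ϑ => Real.exp (-β * u ϑ)) (fun _ _ => (Real.exp_pos _).le)
      (Finset.mem_univ θ)
  have h2 := Real.log_le_log (Real.exp_pos _) h
  rw [Real.log_exp] at h2
  rw [softMin, neg_le, le_div_iff₀ hβ]
  linarith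

variable [Nonempty I]

theorem sum_exp_pos (u : I → ℝ) : 0 < ∑ θ, Real.exp (-β * u θ) :=
  Finset.sum_pos (fun _ _ => Real.exp_pos _) Finset.univ_nonempty

theorem sum_expWeight (u : I → ℝ) : ∑ θ, expWeight β u θ = 1 := by
  simp only [expWeight, ← Finset.sum_div]
  exact div_self (sum_exp_pos u).ne'

theorem continuous_expWeight (θ : I) : Continuous fun u : I → ℝ => expWeight β u θ := by
  unfold expWeight
  exact Continuous.div (by fun_prop) (by fun_prop) fun u => (sum_exp_pos u).ne'

/-- Linear growth, so that integrable losses have an integrable soft minimum. -/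
theorem abs_softMin_le (hβ : 0 < β) (u : I → ℝ) :
    |softMin β u| ≤ ∑ θ, |u θ| + Real.log (Fintype.card I) / β := by
  have hcard : 0 ≤ Real.log (Fintype.card I) / β :=
    div_nonneg (Real.log_natCast_nonneg _) hβ.le
  have hle : ∀ θ, |u θ| ≤ ∑ ϑ, |u ϑ| := fun θ =>
    Finset.single_le_sum (f := fun ϑ => |u ϑ|) (fun _ _ => abs_nonneg _) (Finset.mem_univ θ)
  rw [abs_le]
  constructor
  · have h : ∑ θ, Real.exp (-β * u θ) ≤ Fintype.card I * Real.exp (β * ∑ θ, |u θ|) := by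
      rw [← nsmul_eq_mul, ← Finset.card_univ]
      refine Finset.sum_le_card_nsmul _ _ _ fun θ _ => Real.exp_le_exp.2 ?_
      nlinarith [hle θ, neg_abs_le (u θ)]
    have h2 := Real.log_le_log (sum_exp_pos u) h
    rw [Real.log_mul (by simp) (Real.exp_pos _).ne', Real.log_exp] at h2
    have h3 : Real.log (∑ θ, Real.exp (-β * u θ)) / β
        ≤ (Real.log (Fintype.card I) + β * ∑ θ, |u θ|) / β :=
      div_le_div_of_nonneg_right h2 hβ.le
    rw [add_div, mul_div_cancel_left₀ _ hβ.ne'] at h3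
    rw [softMin]
    linarith
  · obtain ⟨θ⟩ := ‹Nonempty I›
    linarith [softMin_le hβ u θ, hle θ, le_abs_self (u θ)]

/-- The exponentially weighted mean of `exp(-β v)` in terms of increments of the soft minimum. -/
theorem sum_expWeight_mul_exp (hβ : 0 < β) (u v : I → ℝ) :
    ∑ θ, expWeight β u θ * Real.exp (-β * v θ)
      = Real.exp (-β * (softMin β (u + v) - softMin β u)) := by
  have e : -β * (softMin β (u + v) - softMin β u)
      = Real.log (∑ θ, Real.exp (-β * (u + v) θ)) - Real.log (∑ θ, Real.exp (-β * u θ)) := by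
    rw [softMin, softMin]
    field_simp
    ring
  rw [e, Real.exp_sub, Real.exp_log (sum_exp_pos _), Real.exp_log (sum_exp_pos _), Finset.sum_div]
  refine Finset.sum_congr rfl fun θ _ => ?_
  rw [expWeight, Pi.add_apply, mul_add, Real.exp_add]
  ring

end ExponentialWeights

/-! ### Extended expectations -/

theorem extExpectation_eq_integral {Ω : Type*} [MeasurableSpace Ω] {μ : Measure Ω} {X : Ω → ℝ}
    (hX : Integrable X μ) : extExpectation μ X = ((∫ ω, X ω ∂μ : ℝ) : EReal) := by
  have h1 : ∫⁻ ω, ENNReal.ofReal (X ω) ∂μ ≠ ⊤ := hX.lintegral_lt_top.ne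
  have h2 : ∫⁻ ω, ENNReal.ofReal (-X ω) ∂μ ≠ ⊤ := hX.neg.lintegral_lt_top.ne
  rw [integral_eq_lintegral_pos_part_sub_lintegral_neg_part hX, EReal.coe_sub,
    EReal.coe_ennreal_toReal h1, EReal.coe_ennreal_toReal h2, extExpectation]

/-- No integrability is needed: the positive part grows while the negative part shrinks. This
matters because the estimator's loss may have expectation `-∞`. -/
theorem extExpectation_mono {Ω : Type*} [MeasurableSpace Ω] {μ : Measure Ω} {X Y : Ω → ℝ}
    (h : ∀ ω, X ω ≤ Y ω) : extExpectation μ X ≤ extExpectation μ Y :=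
  EReal.sub_le_sub
    (EReal.coe_ennreal_le_coe_ennreal_iff.2
      (lintegral_mono fun ω => ENNReal.ofReal_le_ofReal (h ω)))
    (EReal.coe_ennreal_le_coe_ennreal_iff.2
      (lintegral_mono fun ω => ENNReal.ofReal_le_ofReal (neg_le_neg (h ω))))

/-! ### Pathwise bound for the forecaster -/

section Forecaster

variable {M 𝒵 : Type*} {n : ℕ}

/-- The vector of cumulative losses of the experts in `Θ`. -/
noncomputable def lossVec (ℓ : M → 𝒵 → ℝ) (Θ : Finset M) (z : Fin n → 𝒵) (t : Fin (n + 1)) :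
    Θ → ℝ := fun θ => cumLoss ℓ z t θ

theorem ewaWeight_eq_expWeight (β : ℝ) (ℓ : M → 𝒵 → ℝ) (Θ : Finset M) (z : Fin n → 𝒵)
    (t : Fin (n + 1)) (θ : Θ) :
    ewaWeight β ℓ Θ z t θ = expWeight β (lossVec ℓ Θ z t) θ := by
  rw [ewaWeight, expWeight, ← Finset.sum_coe_sort Θ]
  rfl

theorem lossVec_zero (ℓ : M → 𝒵 → ℝ) (Θ : Finset M) (z : Fin n → 𝒵) : lossVec ℓ Θ z 0 = 0 := by
  ext θ
  simp [lossVec, cumLoss]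

theorem lossVec_last (ℓ : M → 𝒵 → ℝ) (Θ : Finset M) (z : Fin n → 𝒵) (θ : Θ) :
    lossVec ℓ Θ z (Fin.last n) θ = ∑ j, ℓ θ (z j) := by
  simp [lossVec, cumLoss]

theorem lossVec_succ (ℓ : M → 𝒵 → ℝ) (Θ : Finset M) (z : Fin n → 𝒵) (i : Fin n) :
    lossVec ℓ Θ z i.succ = lossVec ℓ Θ z i.castSucc + fun θ : Θ => ℓ θ (z i) := by
  ext θ
  have h : Finset.univ.filter (fun j : Fin n => j.val < i.succ.val)
      = insert i (Finset.univ.filter (fun j : Fin n => j.val < i.castSucc.val)) := by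
    ext j
    simp only [Finset.mem_filter, Finset.mem_univ, true_and, Finset.mem_insert, Fin.val_succ,
      Fin.val_castSucc, Fin.ext_iff]
    omega
  simp only [lossVec, cumLoss, Pi.add_apply]
  rw [h, Finset.sum_insert (by simp), add_comm]

theorem measurable_lossVec [MeasurableSpace 𝒵] {ℓ : M → 𝒵 → ℝ} (hℓ : ∀ θ, Measurable (ℓ θ))
    (Θ : Finset M) (t : Fin (n + 1)) : Measurable fun z : Fin n → 𝒵 => lossVec ℓ Θ z t := by
  unfold lossVec cumLoss
  exact measurable_pi_lambda _ fun θ =>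
    Finset.measurable_fun_sum _ fun j _ => (hℓ θ).comp (measurable_pi_apply j)

variable [MeasurableSpace M] {β : ℝ} {ℓ : M → 𝒵 → ℝ} {Θ : Finset M}

theorem ewaMeasure_eq (z : Fin n → 𝒵) (t : Fin (n + 1)) :
    ewaMeasure β ℓ Θ z t
      = ∑ θ : Θ, ENNReal.ofReal (expWeight β (lossVec ℓ Θ z t) θ) • Measure.dirac (θ : M) := by
  rw [ewaMeasure, ← Finset.sum_coe_sort Θ]
  exact Finset.sum_congr rfl fun θ _ => by rw [ewaWeight_eq_expWeight]

theorem otbMeasure_eq [MetricSpace M] [Nonempty M] (z : Fin n → 𝒵) :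
    otbMeasure β ℓ Θ z = ∑ t : Fin (n + 1),
      ENNReal.ofReal (((n : ℝ) + 1)⁻¹) • Measure.dirac (ewaPrediction β ℓ Θ z t) := by
  have h : ENNReal.ofReal (((n : ℝ) + 1)⁻¹) = ((n : ℝ≥0∞) + 1)⁻¹ := by
    rw [ENNReal.ofReal_inv_of_pos (by positivity), ENNReal.ofReal_add (by positivity) zero_le_one,
      ENNReal.ofReal_natCast, ENNReal.ofReal_one]
  rw [otbMeasure, h]

theorem sum_uniform_weight (n : ℕ) : ∑ _t : Fin (n + 1), ((n : ℝ) + 1)⁻¹ = 1 := by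
  rw [Finset.sum_const, Finset.card_univ, Fintype.card_fin, nsmul_eq_mul, Nat.cast_add,
    Nat.cast_one]
  exact mul_inv_cancel₀ (by positivity)

variable [MetricSpace M] [CompleteSpace M] [Nonempty M] [BorelSpace M] [Nonempty Θ]

/-- The estimator is a continuous function of the loss vectors. -/
theorem exists_continuous_otbEstimator (hM : IsNPCSpace M) (β : ℝ) (ℓ : M → 𝒵 → ℝ)
    (Θ : Finset M) [Nonempty Θ] (n : ℕ) :
    ∃ Φ : (Fin (n + 1) → Θ → ℝ) → M, Continuous Φ ∧
      ∀ z : Fin n → 𝒵, otbEstimator β ℓ Θ z = Φ (lossVec ℓ Θ z) := by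
  set p : (Θ → ℝ) → M := fun u =>
    barycenter (∑ θ : Θ, ENNReal.ofReal (expWeight β u θ) • Measure.dirac (θ : M)) with hp
  have hpc : Continuous p := continuous_barycenter_sum_dirac hM (fun u => expWeight_nonneg u)
    sum_expWeight continuous_expWeight fun θ => continuous_const
  refine ⟨fun v => barycenter (∑ t : Fin (n + 1),
    ENNReal.ofReal (((n : ℝ) + 1)⁻¹) • Measure.dirac (p (v t))), ?_, fun z => ?_⟩
  · exact continuous_barycenter_sum_dirac hM (fun _ _ => by positivity)
      (fun _ => sum_uniform_weight n) (fun _ => continuous_const)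
      (fun t => hpc.comp (continuous_apply t))
  · simp only [otbEstimator, otbMeasure_eq, ewaPrediction, ewaMeasure_eq, hp]

/-- The loss of the estimator is at most the average of the mix losses. -/
theorem loss_otbEstimator_le (hM : IsNPCSpace M) (hβ : 0 < β)
    (hℓ_lsc : ∀ z : 𝒵, LowerSemicontinuous (fun m : M => ℓ m z))
    (hℓ_conc : ∀ z : 𝒵, GeodesicallyConcave (fun m : M => Real.exp (-β * ℓ m z)))
    (z : Fin n → 𝒵) (z' : 𝒵) :
    ℓ (otbEstimator β ℓ Θ z) z' ≤ ((n : ℝ) + 1)⁻¹ * ∑ t : Fin (n + 1),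
      (softMin β (lossVec ℓ Θ z t + fun θ : Θ => ℓ θ z') - softMin β (lossVec ℓ Θ z t)) := by
  set G : Fin (n + 1) → ℝ := fun t =>
    softMin β (lossVec ℓ Θ z t + fun θ : Θ => ℓ θ z') - softMin β (lossVec ℓ Θ z t) with hG
  have hlsc : LowerSemicontinuous fun m : M => -Real.exp (-β * ℓ m z') :=
    Continuous.comp_lowerSemicontinuous (g := fun s : ℝ => -Real.exp (-β * s)) (by fun_prop)
      (hℓ_lsc z') fun s s' h => neg_le_neg (Real.exp_le_exp.2 (by nlinarith))
  -- Jensen for the convex function `-exp (-β ℓ)` at the `t`-th prediction; the weighted mean is the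
  -- potential increment.
  have hpred : ∀ t, Real.exp (-β * G t) ≤ Real.exp (-β * ℓ (ewaPrediction β ℓ Θ z t) z') := by
    intro t
    have hb := isWeightedBary_barycenter (x := fun θ : Θ => (θ : M)) hM
      (fun θ => expWeight_nonneg (β := β) (lossVec ℓ Θ z t) θ) (sum_expWeight _)
    have hj := hb.jensen hM (fun θ => expWeight_nonneg _ θ) (sum_expWeight _) hlsc (hℓ_conc z')
    simp only [mul_neg, Finset.sum_neg_distrib] at hj
    rw [← ewaMeasure_eq, neg_le_neg_iff] at hj
    rw [hG, ← sum_expWeight_mul_exp hβ]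
    exact hj
  have hw : ∀ _t : Fin (n + 1), (0 : ℝ) ≤ ((n : ℝ) + 1)⁻¹ := fun _ => by positivity
  have hb := isWeightedBary_barycenter (x := ewaPrediction β ℓ Θ z) hM hw (sum_uniform_weight n)
  have hj := hb.jensen hM hw (sum_uniform_weight n) hlsc (hℓ_conc z')
  simp only [mul_neg, Finset.sum_neg_distrib] at hj
  rw [← otbMeasure_eq, neg_le_neg_iff] at hj
  -- Convexity of `exp` moves the average over `t` into the exponent, so the bounds chain and the
  -- exponents can be compared.
  have hexp := convexOn_exp.map_sum_le (t := Finset.univ) (p := fun t => -β * G t)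
    (fun t _ => hw t) (sum_uniform_weight n) (fun _ _ => mem_univ _)
  simp only [smul_eq_mul] at hexp
  have hmain := (hexp.trans (Finset.sum_le_sum fun t _ =>
    mul_le_mul_of_nonneg_left (hpred t) (hw t))).trans hj
  rw [Real.exp_le_exp, ← Finset.mul_sum, ← Finset.mul_sum] at hmain
  have : β * ℓ (otbEstimator β ℓ Θ z) z' ≤ β * (((n : ℝ) + 1)⁻¹ * ∑ t, G t) := by
    rw [otbEstimator]
    linarith
  exact le_of_mul_le_mul_left this hβ

end Forecaster

/-! ### Exchange of observations and the risk bound -/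

/-- Replacing the next observation by a fresh one does not change the law of the loss vector. -/
theorem identDistrib_lossVec_succ {M 𝒵 : Type*} [MeasurableSpace 𝒵] {ℓ : M → 𝒵 → ℝ}
    (hℓ : ∀ θ, Measurable (ℓ θ)) (Θ : Finset M) {n : ℕ}
    {Ω : Type*} [MeasurableSpace Ω] {μ : Measure Ω} [IsProbabilityMeasure μ]
    {Z : Fin n → Ω → 𝒵} {Znew : Ω → 𝒵} (hZ_meas : ∀ i, Measurable (Z i))
    (hZ_indep : iIndepFun Z μ) (hZnew_indep : IndepFun (fun ω i => Z i ω) Znew μ)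
    (hZ_law : ∀ i, IdentDistrib (Z i) Znew μ μ) (i : Fin n) :
    IdentDistrib (fun ω => lossVec ℓ Θ (fun j => Z j ω) i.succ)
      (fun ω => lossVec ℓ Θ (fun j => Z j ω) i.castSucc + fun θ : Θ => ℓ θ (Znew ω)) μ μ := by
  set U : Ω → Θ → ℝ := fun ω => lossVec ℓ Θ (fun j => Z j ω) i.castSucc with hU
  have hUm : Measurable U :=
    (measurable_lossVec hℓ Θ i.castSucc).comp (measurable_pi_lambda _ hZ_meas)
  have hnew : IndepFun U Znew μ :=
    hZnew_indep.comp (measurable_lossVec hℓ Θ i.castSucc) measurable_id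
  -- `U` involves only the observations with index below `i`.
  have hold : IndepFun U (Z i) μ := by
    set S := Finset.univ.filter (fun j : Fin n => j.val < i.castSucc.val) with hS
    have h := hZ_indep.indepFun_finset S {i} (by simp [hS]) hZ_meas
    have hφ : Measurable fun (y : S → 𝒵) (θ : Θ) => ∑ j : S, ℓ θ (y j) :=
      measurable_pi_lambda _ fun θ =>
        Finset.measurable_fun_sum _ fun j _ => (hℓ θ).comp (measurable_pi_apply j)
    have h2 := h.comp hφ (measurable_pi_apply (⟨i, Finset.mem_singleton_self i⟩ : ({i} : Finset _)))
    have hUeq : U = (fun (y : S → 𝒵) (θ : Θ) => ∑ j : S, ℓ θ (y j)) ∘ fun ω (j : S) => Z j ω := by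
      ext ω θ
      exact (Finset.sum_coe_sort S fun j => ℓ θ (Z j ω)).symm
    rw [hUeq]
    exact h2
  have hpair := IdentDistrib.prodMk (IdentDistrib.refl hUm.aemeasurable) (hZ_law i) hold hnew
  have hg : Measurable fun q : (Θ → ℝ) × 𝒵 => q.1 + fun θ : Θ => ℓ θ q.2 :=
    measurable_fst.add (measurable_pi_lambda _ fun θ => (hℓ θ).comp measurable_snd)
  have := hpair.comp hg
  simpa only [lossVec_succ, Function.comp_def] using this

theorem integrable_softMin {I : Type*} [Fintype I] [Nonempty I] {β : ℝ} (hβ : 0 < β)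
    {Ω : Type*} [MeasurableSpace Ω] {μ : Measure Ω} [IsFiniteMeasure μ] {U : Ω → I → ℝ}
    (hU : ∀ θ, Integrable (fun ω => U ω θ) μ) : Integrable (fun ω => softMin β (U ω)) μ := by
  have hm : AEMeasurable U μ := aemeasurable_pi_lambda _ fun θ => (hU θ).aemeasurable
  have hb : Integrable (fun ω => ∑ θ, |U ω θ| + Real.log (Fintype.card I) / β) μ :=
    (integrable_finsetSum _ fun θ _ => (hU θ).abs).add (integrable_const _)
  exact hb.mono' (measurable_softMin.comp_aemeasurable hm).aestronglyMeasurable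
    (ae_of_all _ fun ω => abs_softMin_le hβ (U ω))

theorem mainTheorem5
    {M : Type*} [MetricSpace M] [CompleteSpace M] [Nonempty M] [MeasurableSpace M] [BorelSpace M]
    (hM : IsNPCSpace M)
    {𝒵 : Type*} [MeasurableSpace 𝒵]
    (ℓ : M → 𝒵 → ℝ) (hℓ_meas : Measurable (fun p : M × 𝒵 => ℓ p.1 p.2))
    (hℓ_lsc : ∀ z : 𝒵, LowerSemicontinuous (fun m : M => ℓ m z))
    (β : ℝ) (hβ : 0 < β)
    (hℓ_conc : ∀ z : 𝒵, GeodesicallyConcave (fun m : M => Real.exp (-β * ℓ m z)))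
    (Θ : Finset M) (hΘ : Θ.Nonempty)
    (n : ℕ) (hn : 1 ≤ n)
    {Ω : Type*} [MeasurableSpace Ω] (μ : Measure Ω) [IsProbabilityMeasure μ]
    (Z : Fin n → Ω → 𝒵) (Znew : Ω → 𝒵)
    (hZ_meas : ∀ i, Measurable (Z i)) (hZnew_meas : Measurable Znew)
    (hZ_indep : iIndepFun Z μ)
    (hZnew_indep : IndepFun (fun ω i => Z i ω) Znew μ)
    (hZ_law : ∀ i, IdentDistrib (Z i) Znew μ μ)
    (hℓ_int : ∀ θ ∈ Θ, Integrable (fun ω => ℓ θ (Znew ω)) μ) :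
    -- the barycenters defining the predictions and the estimator exist and are unique
    (∀ (z : Fin n → 𝒵) (t : Fin (n + 1)), ∃! x : M, IsBarycenter (ewaMeasure β ℓ Θ z t) x) ∧
    (∀ z : Fin n → 𝒵, ∃! x : M, IsBarycenter (otbMeasure β ℓ Θ z) x) ∧
    -- the expected loss of the estimator is well defined, with a value in `[-∞, ∞)`
    Measurable (fun ω => ℓ (otbEstimator β ℓ Θ (fun i => Z i ω)) (Znew ω)) ∧
    ∫⁻ ω, ENNReal.ofReal (ℓ (otbEstimator β ℓ Θ (fun i => Z i ω)) (Znew ω)) ∂μ < ⊤ ∧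
    -- the excess risk bound
    extExpectation μ (fun ω => ℓ (otbEstimator β ℓ Θ (fun i => Z i ω)) (Znew ω))
        - (⨅ θ ∈ Θ, extExpectation μ (fun ω => ℓ θ (Znew ω)))
      ≤ ((Real.log (Θ.card : ℝ) / (β * ((n : ℝ) + 1)) : ℝ) : EReal) := by
  have hne : Nonempty Θ := hΘ.to_subtype
  have hℓθ : ∀ θ, Measurable (ℓ θ) := fun θ => hℓ_meas.comp measurable_prodMk_left
  have hZpi : Measurable fun ω i => Z i ω := measurable_pi_lambda _ hZ_meas
  set U : Fin (n + 1) → Ω → Θ → ℝ := fun t ω => lossVec ℓ Θ (fun i => Z i ω) t with hUdef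
  set N : Ω → Θ → ℝ := fun ω θ => ℓ θ (Znew ω) with hN
  set X : Ω → ℝ := fun ω => ℓ (otbEstimator β ℓ Θ (fun i => Z i ω)) (Znew ω) with hX
  set H : Ω → ℝ := fun ω => ((n : ℝ) + 1)⁻¹ * ∑ t : Fin (n + 1),
    (softMin β (U t ω + N ω) - softMin β (U t ω)) with hH
  have hXH : ∀ ω, X ω ≤ H ω := fun ω =>
    loss_otbEstimator_le hM hβ hℓ_lsc hℓ_conc (fun i => Z i ω) (Znew ω)
  have hZint : ∀ (θ : Θ) i, Integrable (fun ω => ℓ θ (Z i ω)) μ := fun θ i =>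
    ((hZ_law i).comp (hℓθ θ)).integrable_iff.2 (hℓ_int θ θ.2)
  have hNint : ∀ θ : Θ, Integrable (fun ω => N ω θ) μ := fun θ => hℓ_int θ θ.2
  have hUint : ∀ t (θ : Θ), Integrable (fun ω => U t ω θ) μ := fun t θ => by
    simp only [hUdef, lossVec, cumLoss]
    exact integrable_finsetSum _ fun i _ => hZint θ i
  have hA : ∀ t, Integrable (fun ω => softMin β (U t ω + N ω)) μ := fun t =>
    integrable_softMin hβ fun θ => (hUint t θ).add (hNint θ)
  have hB : ∀ t, Integrable (fun ω => softMin β (U t ω)) μ := fun t =>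
    integrable_softMin hβ (hUint t)
  have hAB : ∀ t, Integrable (fun ω => softMin β (U t ω + N ω) - softMin β (U t ω)) μ :=
    fun t => (hA t).sub (hB t)
  have hHint : Integrable H μ :=
    (integrable_finsetSum _ fun t _ => hAB t).const_mul _
  have hshift : ∀ i : Fin n, ∫ ω, softMin β (U i.succ ω) ∂μ
      = ∫ ω, softMin β (U i.castSucc ω + N ω) ∂μ := fun i =>
    ((identDistrib_lossVec_succ hℓθ Θ hZ_meas hZ_indep hZnew_indep hZ_law i).comp
      measurable_softMin).integral_eq
  have hcard : Fintype.card Θ = Θ.card := Fintype.card_coe Θ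
  have hHval : ∫ ω, H ω ∂μ = ((n : ℝ) + 1)⁻¹ *
      (∫ ω, softMin β (U (Fin.last n) ω + N ω) ∂μ + Real.log Θ.card / β) := by
    rw [hH, integral_const_mul, integral_finsetSum _ fun t _ => hAB t]
    congr 1
    simp only [fun t => integral_sub (hA t) (hB t)]
    -- The first sum gives up its last term and the second its initial one; `hshift` cancels the
    -- rest.
    rw [Finset.sum_sub_distrib, Fin.sum_univ_castSucc, Fin.sum_univ_succ (n := n)]
    simp only [hshift]
    have h0 : ∀ ω, softMin β (U 0 ω) = -(Real.log Θ.card / β) := fun ω => by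
      rw [hUdef]
      simp only [lossVec_zero, softMin_zero, hcard]
    simp only [h0, integral_const, probReal_univ, one_smul]
    ring
  have hbound : ∀ θ ∈ Θ, ∫ ω, H ω ∂μ
      ≤ ∫ ω, ℓ θ (Znew ω) ∂μ + Real.log Θ.card / (β * ((n : ℝ) + 1)) := by
    intro θ hθ
    have h1 : ∫ ω, softMin β (U (Fin.last n) ω + N ω) ∂μ
        ≤ ∫ ω, (U (Fin.last n) ω ⟨θ, hθ⟩ + N ω ⟨θ, hθ⟩) ∂μ :=
      integral_mono (hA _) ((hUint _ ⟨θ, hθ⟩).add (hNint ⟨θ, hθ⟩)) fun ω =>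
        softMin_le hβ (U (Fin.last n) ω + N ω) ⟨θ, hθ⟩
    -- The `n` observations and the fresh outcome contribute `n + 1` equal expectations, hence the
    -- rate `1/(n+1)`.
    have h2 : ∫ ω, (U (Fin.last n) ω ⟨θ, hθ⟩ + N ω ⟨θ, hθ⟩) ∂μ
        = ((n : ℝ) + 1) * ∫ ω, ℓ θ (Znew ω) ∂μ := by
      rw [integral_add (hUint _ _) (hNint _)]
      simp only [hUdef, lossVec_last]
      rw [integral_finsetSum _ fun i _ => hZint ⟨θ, hθ⟩ i]
      have : ∀ i, ∫ ω, ℓ θ (Z i ω) ∂μ = ∫ ω, ℓ θ (Znew ω) ∂μ := fun i =>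
        ((hZ_law i).comp (hℓθ θ)).integral_eq
      simp only [this, hN, Finset.sum_const, Finset.card_univ, Fintype.card_fin, nsmul_eq_mul]
      ring
    rw [hHval]
    rw [h2] at h1
    refine (mul_le_mul_of_nonneg_left (add_le_add_left h1 _) (by positivity)).trans_eq ?_
    field_simp
  refine ⟨fun z t => ?_, fun z => ?_, ?_, ?_, ?_⟩
  · rw [ewaMeasure_eq]
    exact existsUnique_isBarycenter_sum_dirac hM (fun θ => expWeight_nonneg _ θ) (sum_expWeight _)
  · rw [otbMeasure_eq]
    exact existsUnique_isBarycenter_sum_dirac hM (fun _ => by positivity) (sum_uniform_weight n)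
  · obtain ⟨Φ, hΦ, hΦeq⟩ := exists_continuous_otbEstimator hM β ℓ Θ n
    have hmeas : Measurable fun ω => otbEstimator β ℓ Θ (fun i => Z i ω) := by
      simp only [hΦeq]
      exact hΦ.measurable.comp (measurable_pi_lambda _ fun t =>
        (measurable_lossVec hℓθ Θ t).comp hZpi)
    exact hℓ_meas.comp (hmeas.prodMk hZnew_meas)
  · exact (lintegral_mono fun ω => ENNReal.ofReal_le_ofReal (hXH ω)).trans_lt
      hHint.lintegral_lt_top
  · obtain ⟨θ₀, hθ₀, hmin⟩ := Θ.exists_min_image (fun θ => ∫ ω, ℓ θ (Znew ω) ∂μ) hΘ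
    have hinf : ((∫ ω, ℓ θ₀ (Znew ω) ∂μ : ℝ) : EReal)
        ≤ ⨅ θ ∈ Θ, extExpectation μ (fun ω => ℓ θ (Znew ω)) := by
      refine le_iInf₂ fun θ hθ => ?_
      rw [extExpectation_eq_integral (hℓ_int θ hθ)]
      exact EReal.coe_le_coe_iff.2 (hmin θ hθ)
    -- Only the integrable majorant `H` is integrated, never `X` itself.
    have hup : extExpectation μ X ≤ ((∫ ω, H ω ∂μ : ℝ) : EReal) :=
      (extExpectation_mono hXH).trans_eq (extExpectation_eq_integral hHint)
    refine (EReal.sub_le_sub hup hinf).trans ?_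
    rw [← EReal.coe_sub, EReal.coe_le_coe_iff]
    linarith [hbound θ₀ hθ₀]
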